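/- Let $a,b$ be real numbers with $b>0$, $a\sqrt2>b+2$, $b<\frac{a^2-1}{2a+1}$ and $2a+b<4$, let $L(x,y)=(1+y-a|x|,\,bx)$ be the Lozi map, let $X=\left(\frac1{1+a-b},\frac b{1+a-b}\right)$ be its fixed point in the first quadrant, and let $R=W^u_X=\{T: L^{-n}(T)\to X\}$ be its unstable manifold. $R$ is the image of the real line under a continuous one-to-one map; arcs in $R$ and neighbourhoods in $R$ are understood with respect to this parametrization by the line (not in the topology induced from the plane). An itinerary of a point $P\in R$ is a sequence $\bar p=(p_n)_{n\in\mathbb Z}\in\{+1,-1\}^{\mathbb Z}$ such that, for all $n\in\mathbb Z$, the $x$-coordinate of $L^n(P)$ is $\ge0$ if $p_n=+1$ and $\le0$ if $p_n=-1$. A sequence $\bar p\in\{+1,-1\}^{\mathbb Z}$ is called essential $R$-admissible if it is an itinerary of some $P\in R$ such that, for all integers $k<l$ for which both $L^k(P)$ and $L^l(P)$ lie on the $y$-axis, the sign $p_l$ is the one given by the side on which $R$ stays at $L^l(P)$: for all $Q\in R$, $Q\ne P$, close enough to $P$ in $R$, the $x$-coordinate of $L^l(Q)$ is positive if $p_l=+1$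 and negative if $p_l=-1$. A gluing point is a point $G\in R$ on the $y$-axis such that $L^{-k}(G)$ is not on the $y$-axis for any integer $k\ge1$. The basic points are the points $L^j(G)$, where $G$ is a gluing point and $j\ge0$. The basic arcs are the arcs of $R$ whose endpoints are two consecutive basic points. The folding tree is the Markov transition graph of the basic arcs: its vertices are the basic arcs, and there is an arrow from $B$ to $B'$ if and only if $L(B)\supset B'$. The sign of a vertex $B$ is $+1$ if $B\subset\{x\ge0\}$ and $-1$ if $B\subset\{x\le0\}$. A sign-path is the bi-infinite sequence of signs $(p_n)_{n\in\mathbb Z}$ of the vertices of a bi-infinite path $(B_n)_{n\in\mathbb Z}$ in the folding tree. Theorem. Let $\bar p\in\{+1,-1\}^{\mathbb Z}$. Then $\bar p$ is essential $R$-admissible if and only if it is a sign-path in the folding tree. -/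

import Mathlib

open Filter Topology Set

/-- The Lozi map `L(x, y) = (1 + y - a|x|, b x)`, as a bijection of the plane (for `b > 0`).
Its iterates, forward and backward, are the integer powers in `Equiv.Perm (ℝ × ℝ)`. -/
noncomputable def lozi (a b : ℝ) (hb : 0 < b) : Equiv.Perm (ℝ × ℝ) where
  toFun P := (1 + P.2 - a * |P.1|, b * P.1)
  invFun P := (P.2 / b, P.1 - 1 + a * |P.2 / b|)
  left_inv P := by
    have h : b * P.1 / b = P.1 := by field_simp
    ext
    · exact h
    · simp only [h]; ring
  right_inv P := by
    ext
    · simp only; ring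
    · simp only; field_simp

/-- The fixed point `X` in the first quadrant. -/
noncomputable def loziX (a b : ℝ) : ℝ × ℝ := (1 / (1 + a - b), b / (1 + a - b))

/-- `W^u_X`: the points whose backward orbit converges to `X`. -/
def unstableManifold (a b : ℝ) (hb : 0 < b) : Set (ℝ × ℝ) :=
  {T | Tendsto (fun n : ℕ => ((lozi a b hb) ^ (-(n : ℤ))) T) atTop (𝓝 (loziX a b))}

/-- The unstable eigenvalue of the linear part of `L` at `X`, that is of `(x, y) ↦ (y - a x, b x)`;
`(1, b / unstableEigenvalue a b)` is an eigenvector for it, pointing to the right. -/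
noncomputable def unstableEigenvalue (a b : ℝ) : ℝ := -(a + √(a ^ 2 + 4 * b)) / 2

/-- The line through `X` in the unstable direction. -/
noncomputable def unstableLine (a b t : ℝ) : ℝ × ℝ :=
  loziX a b + t • (1, b / unstableEigenvalue a b)

/-- The one-to-one parametrization of the broken line `W^u_X` by the real line:
`φ(t) = lim L^n (X + λ^{-n} t v)`, where `λ`, `v` are the unstable eigenvalue and eigenvector
at `X`. The sequence is eventually constant, because `L` is affine near `X`. See
`unstableParam_eq`, `continuous_unstableParam`, `injective_unstableParam`,
`range_unstableParam` and `lozi_unstableParam` below. Arcs of `W^u_X` and neighbourhoods in `W^u_X`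
(regarded as a line, not as a subspace of the plane) are taken through it. -/
noncomputable def unstableParam (a b : ℝ) (hb : 0 < b) (t : ℝ) : ℝ × ℝ :=
  limUnder atTop fun n : ℕ =>
    ((lozi a b hb) ^ n) (unstableLine a b ((unstableEigenvalue a b)⁻¹ ^ n * t))

/-- Gluing points: the points of `W^u_X` on the `y`-axis none of whose preimages `L^{-k}`, `k ≥ 1`,
is on the `y`-axis. -/
def gluingPoints (a b : ℝ) (hb : 0 < b) : Set (ℝ × ℝ) :=
  {G | G ∈ unstableManifold a b hb ∧ G.1 = 0 ∧
    ∀ k : ℕ, 1 ≤ k → (((lozi a b hb) ^ (-(k : ℤ))) G).1 ≠ 0}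

/-- Basic points: the gluing points and all their forward images (turning points, which are the
first images, and postturning points). -/
def basicPoints (a b : ℝ) (hb : 0 < b) : Set (ℝ × ℝ) :=
  {E | ∃ G ∈ gluingPoints a b hb, ∃ j : ℕ, E = ((lozi a b hb) ^ j) G}

/-- Basic arcs: the arcs of `W^u_X` between two consecutive basic points. -/
def IsBasicArc (a b : ℝ) (hb : 0 < b) (B : Set (ℝ × ℝ)) : Prop :=
  ∃ s t : ℝ, s < t ∧
    unstableParam a b hb s ∈ basicPoints a b hb ∧
    unstableParam a b hb t ∈ basicPoints a b hb ∧
    (∀ u ∈ Ioo s t, unstableParam a b hb u ∉ basicPoints a b hb) ∧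
    B = unstableParam a b hb '' Icc s t

/-- The folding tree: the vertices are the basic arcs, with an arrow from `B` to `B'` if and only
if `L(B) ⊇ B'`. -/
def foldingTree (a b : ℝ) (hb : 0 < b) : Digraph {B : Set (ℝ × ℝ) // IsBasicArc a b hb B} where
  Adj B B' := (B' : Set (ℝ × ℝ)) ⊆ lozi a b hb '' (B : Set (ℝ × ℝ))

/-- The sign `s = ±1` of a basic arc `B`: `B` lies in the closed right half-plane for `s = 1`, and
in the closed left one for `s = -1`. -/
def HasSign (B : Set (ℝ × ℝ)) (s : ℤˣ) : Prop :=
  ∀ P ∈ B, 0 ≤ ((s : ℤ) : ℝ) * P.1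

/-- `p` is the sequence of signs of the vertices of a bi-infinite path in the folding tree. -/
def IsSignPath (a b : ℝ) (hb : 0 < b) (p : ℤ → ℤˣ) : Prop :=
  ∃ B : ℤ → {B : Set (ℝ × ℝ) // IsBasicArc a b hb B},
    (∀ n, (foldingTree a b hb).Adj (B n) (B (n + 1))) ∧
    ∀ n, HasSign (B n) (p n)

/-- `p` is an itinerary of `P`: for all `n`, if `p n = 1` then `L^n(P)` has `x`-coordinate `≥ 0`,
and if `p n = -1` then it has `x`-coordinate `≤ 0`. -/
def IsItinerary (a b : ℝ) (hb : 0 < b) (P : ℝ × ℝ) (p : ℤ → ℤˣ) : Prop :=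
  ∀ n : ℤ, 0 ≤ ((p n : ℤ) : ℝ) * (((lozi a b hb) ^ n) P).1

/-- `p` is essential `R`-admissible, `R = W^u_X`: it is an itinerary of a point `P = φ(t)` of `R`,
and whenever `L^l(P)` is on the `y`-axis, but not for the first time along the orbit of `P`,
then the sign `p l` is the one dictated by the side of the `y`-axis on which `L^l(Q)` lies for all
`Q ≠ P` near `P` in `R`. (At the first time both signs are allowed.) -/
def IsEssentialRAdmissible (a b : ℝ) (hb : 0 < b) (p : ℤ → ℤˣ) : Prop :=
  ∃ P ∈ unstableManifold a b hb, IsItinerary a b hb P p ∧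
    ∃ t : ℝ, unstableParam a b hb t = P ∧
      ∀ k l : ℤ, k < l → (((lozi a b hb) ^ k) P).1 = 0 → (((lozi a b hb) ^ l) P).1 = 0 →
        ∀ᶠ s in 𝓝[≠] t, 0 < ((p l : ℤ) : ℝ) * (((lozi a b hb) ^ l) (unstableParam a b hb s)).1

section ParamFacts

theorem unstableEigenvalue_sq {a b : ℝ} (hb : 0 < b) :
    unstableEigenvalue a b ^ 2 + a * unstableEigenvalue a b = b := by
  have h := Real.sq_sqrt (show 0 ≤ a ^ 2 + 4 * b by positivity)
  unfold unstableEigenvalue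
  nlinarith

theorem unstableEigenvalue_lt {a b : ℝ} (hb : 0 < b) (ha : 1 < a) :
    unstableEigenvalue a b < -1 := by
  have h : 1 < √(a ^ 2 + 4 * b) := by
    rw [Real.lt_sqrt zero_le_one]; nlinarith
  unfold unstableEigenvalue
  linarith

theorem div_unstableEigenvalue {a b : ℝ} (hb : 0 < b) (ha : 1 < a) :
    b / unstableEigenvalue a b = unstableEigenvalue a b + a := by
  have h0 : unstableEigenvalue a b ≠ 0 := by linarith [unstableEigenvalue_lt hb ha]
  have := unstableEigenvalue_sq (a := a) hb
  rw [div_eq_iff h0]; linarith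

theorem lozi_apply_of_nonneg {a b : ℝ} (hb : 0 < b) {P : ℝ × ℝ} (hP : 0 ≤ P.1) :
    lozi a b hb P = (1 + P.2 - a * P.1, b * P.1) := by
  change (1 + P.2 - a * |P.1|, b * P.1) = _
  rw [abs_of_nonneg hP]

theorem lozi_unstableLine {a b : ℝ} (hb : 0 < b) (ha : 1 < a) (hba : b < a + 1) {s : ℝ}
    (hs : |s| ≤ (loziX a b).1) :
    lozi a b hb (unstableLine a b s) = unstableLine a b (unstableEigenvalue a b * s) := by
  have h0 : unstableEigenvalue a b ≠ 0 := by linarith [unstableEigenvalue_lt hb ha]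
  have hd : 1 + a - b ≠ 0 := by linarith
  have hx : 0 ≤ (unstableLine a b s).1 := by
    have := neg_abs_le s
    simp [unstableLine]; linarith
  rw [lozi_apply_of_nonneg hb hx]
  have e := div_unstableEigenvalue hb ha
  have e2 := unstableEigenvalue_sq (a := a) hb
  ext
  · simp only [unstableLine, e, loziX]
    simp only [Prod.smul_mk, smul_eq_mul, Prod.mk_add_mk, mul_one]
    field_simp
    ring
  · simp only [unstableLine, e, loziX]
    simp only [Prod.smul_mk, smul_eq_mul, Prod.mk_add_mk, mul_one]
    field_simp
    linear_combination (-s * (1 + a - b)) * e2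

theorem loziX_fst_pos {a b : ℝ} (hba : b < a + 1) : 0 < (loziX a b).1 := by
  have : 0 < 1 + a - b := by linarith
  simp only [loziX]; positivity

theorem abs_inv_unstableEigenvalue {a b : ℝ} (hb : 0 < b) (ha : 1 < a) :
    |(unstableEigenvalue a b)⁻¹| < 1 := by
  have h := unstableEigenvalue_lt hb ha
  rw [abs_inv]
  apply inv_lt_one_of_one_lt₀
  rw [abs_of_neg (by linarith)]; linarith

/-- The sequence that defines `unstableParam` is constant from the index on at which the point on
the line enters the disc of radius `X.1` around `X`. -/
theorem unstableParam_eq {a b : ℝ} (hb : 0 < b) (ha : 1 < a) (hba : b < a + 1) {t : ℝ} {n : ℕ}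
    (hn : |(unstableEigenvalue a b)⁻¹ ^ n * t| ≤ (loziX a b).1) :
    unstableParam a b hb t =
      ((lozi a b hb) ^ n) (unstableLine a b ((unstableEigenvalue a b)⁻¹ ^ n * t)) := by
  have h0 : unstableEigenvalue a b ≠ 0 := by linarith [unstableEigenvalue_lt hb ha]
  have key : ∀ m, n ≤ m → |(unstableEigenvalue a b)⁻¹ ^ m * t| ≤ (loziX a b).1 ∧
      ((lozi a b hb) ^ m) (unstableLine a b ((unstableEigenvalue a b)⁻¹ ^ m * t)) =
      ((lozi a b hb) ^ n) (unstableLine a b ((unstableEigenvalue a b)⁻¹ ^ n * t)) := by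
    intro m hm
    induction m, hm using Nat.le_induction with
    | base => exact ⟨hn, rfl⟩
    | succ m hm ih =>
      have h1 : |(unstableEigenvalue a b)⁻¹ ^ (m + 1) * t| ≤ (loziX a b).1 := by
        rw [pow_succ', mul_assoc, abs_mul]
        exact (mul_le_of_le_one_left (abs_nonneg _)
          (abs_inv_unstableEigenvalue hb ha).le).trans ih.1
      refine ⟨h1, ?_⟩
      rw [pow_succ, Equiv.Perm.mul_apply, lozi_unstableLine hb ha hba h1, ← ih.2]
      congr 2
      rw [pow_succ']
      field_simp
  apply Tendsto.limUnder_eq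
  apply tendsto_const_nhds.congr'
  filter_upwards [eventually_ge_atTop n] with m hm
  exact (key m hm).2.symm

theorem exists_pow_unstableEigenvalue_le {a b : ℝ} (hb : 0 < b) (ha : 1 < a) (hba : b < a + 1)
    (M : ℝ) : ∃ n : ℕ, ∀ t, |t| ≤ M →
      |(unstableEigenvalue a b)⁻¹ ^ n * t| ≤ (loziX a b).1 := by
  have h := (tendsto_pow_atTop_nhds_zero_of_lt_one (abs_nonneg _)
    (abs_inv_unstableEigenvalue hb ha)).mul_const M
  rw [zero_mul] at h
  obtain ⟨n, hn⟩ := (h.eventually (gt_mem_nhds (loziX_fst_pos hba))).exists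
  refine ⟨n, fun t ht => ?_⟩
  rw [abs_mul, abs_pow]
  exact (mul_le_mul_of_nonneg_left ht (by positivity)).trans hn.le

/-- `L` acts on `W^u_X` as the multiplication by the unstable eigenvalue. -/
theorem lozi_unstableParam {a b : ℝ} (hb : 0 < b) (ha : 1 < a) (hba : b < a + 1) (t : ℝ) :
    lozi a b hb (unstableParam a b hb t) = unstableParam a b hb (unstableEigenvalue a b * t) := by
  have h0 : unstableEigenvalue a b ≠ 0 := by linarith [unstableEigenvalue_lt hb ha]
  obtain ⟨n, hn⟩ := exists_pow_unstableEigenvalue_le hb ha hba |t|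
  have h1 := hn t le_rfl
  have e : (unstableEigenvalue a b)⁻¹ ^ (n + 1) * (unstableEigenvalue a b * t) =
      (unstableEigenvalue a b)⁻¹ ^ n * t := by
    rw [pow_succ']; field_simp
  rw [unstableParam_eq hb ha hba h1, unstableParam_eq hb ha hba (n := n + 1) (by rw [e]; exact h1),
    e, pow_succ', Equiv.Perm.mul_apply]

theorem continuous_lozi {a b : ℝ} (hb : 0 < b) : Continuous (lozi a b hb) := by
  change Continuous fun P : ℝ × ℝ => (1 + P.2 - a * |P.1|, b * P.1)
  fun_prop

theorem continuous_unstableParam {a b : ℝ} (hb : 0 < b) (ha : 1 < a) (hba : b < a + 1) :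
    Continuous (unstableParam a b hb) := by
  rw [continuous_iff_continuousAt]
  intro t
  obtain ⟨n, hn⟩ := exists_pow_unstableEigenvalue_le hb ha hba (|t| + 1)
  have hc : Continuous fun s =>
      ((lozi a b hb) ^ n) (unstableLine a b ((unstableEigenvalue a b)⁻¹ ^ n * s)) := by
    have h1 : Continuous ((lozi a b hb) ^ n : Equiv.Perm (ℝ × ℝ)) := by
      rw [Equiv.Perm.coe_pow]; exact (continuous_lozi hb).iterate n
    apply h1.comp
    unfold unstableLine
    fun_prop
  apply hc.continuousAt.congr
  filter_upwards [Metric.ball_mem_nhds t one_pos] with s hs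
  refine (unstableParam_eq hb ha hba (hn s ?_)).symm
  rw [Metric.mem_ball, Real.dist_eq] at hs
  linarith [abs_sub_abs_le_abs_sub s t]

theorem injective_unstableParam {a b : ℝ} (hb : 0 < b) (ha : 1 < a) (hba : b < a + 1) :
    Function.Injective (unstableParam a b hb) := by
  have h0 : unstableEigenvalue a b ≠ 0 := by linarith [unstableEigenvalue_lt hb ha]
  intro s t hst
  obtain ⟨n, hn⟩ := exists_pow_unstableEigenvalue_le hb ha hba (max |s| |t|)
  rw [unstableParam_eq hb ha hba (hn s (le_max_left _ _)),
    unstableParam_eq hb ha hba (hn t (le_max_right _ _))] at hst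
  have h1 := congrArg Prod.fst (((lozi a b hb) ^ n).injective hst)
  simpa [unstableLine, h0] using h1

theorem lozi_zpow_neg_unstableParam {a b : ℝ} (hb : 0 < b) (ha : 1 < a) (hba : b < a + 1)
    (n : ℕ) (t : ℝ) : ((lozi a b hb) ^ (-(n : ℤ))) (unstableParam a b hb t) =
      unstableParam a b hb ((unstableEigenvalue a b)⁻¹ ^ n * t) := by
  have h0 : unstableEigenvalue a b ≠ 0 := by linarith [unstableEigenvalue_lt hb ha]
  rw [zpow_neg, zpow_natCast, Equiv.Perm.inv_eq_iff_eq]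
  induction n generalizing t with
  | zero => simp
  | succ n ih =>
    rw [pow_succ, Equiv.Perm.mul_apply, lozi_unstableParam hb ha hba, ih t]
    congr 2
    rw [pow_succ']
    field_simp

/-- The parametrization covers exactly `W^u_X`. -/
theorem range_unstableParam {a b : ℝ} (hb : 0 < b) (ha : 1 < a) (hba : b < a + 1) :
    range (unstableParam a b hb) = unstableManifold a b hb := by
  have h0 : unstableEigenvalue a b ≠ 0 := by linarith [unstableEigenvalue_lt hb ha]
  have hlam := unstableEigenvalue_lt hb ha
  have hX := loziX_fst_pos hba
  have hq := unstableEigenvalue_sq (a := a) hb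
  have hd : 1 + a - b ≠ 0 := by linarith
  have small : ∀ s, |s| ≤ (loziX a b).1 → unstableParam a b hb s = unstableLine a b s := by
    intro s hs
    rw [unstableParam_eq hb ha hba (n := 0) (by simpa using hs)]
    simp
  apply Subset.antisymm
  · rintro _ ⟨t, rfl⟩
    have h := (tendsto_pow_atTop_nhds_zero_of_abs_lt_one
      (abs_inv_unstableEigenvalue hb ha)).mul_const t
    rw [zero_mul] at h
    have h2 := ((continuous_unstableParam hb ha hba).tendsto 0).comp h
    rw [small 0 (by simpa using hX.le)] at h2
    simp only [unstableLine, zero_smul, add_zero] at h2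
    refine h2.congr fun n => ?_
    rw [lozi_zpow_neg_unstableParam hb ha hba]; rfl
  · intro T hT
    set Q : ℕ → ℝ × ℝ := fun n => ((lozi a b hb) ^ (-(n : ℤ))) T with hQ
    have hTQ : Tendsto Q atTop (𝓝 (loziX a b)) := hT
    have hstep : ∀ n, Q n = lozi a b hb (Q (n + 1)) := by
      intro n
      simp only [hQ]
      rw [← Equiv.Perm.mul_apply, ← zpow_one_add]
      congr 2
      push_cast; ring
    have hQT : ∀ n, T = ((lozi a b hb) ^ n) (Q n) := by
      intro n
      simp only [hQ]
      rw [← zpow_natCast, ← Equiv.Perm.mul_apply, ← zpow_add]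
      simp
    have h1 : Tendsto (fun n => (Q n).1) atTop (𝓝 (loziX a b).1) :=
      (continuous_fst.tendsto _).comp hTQ
    have h2 : Tendsto (fun n => (Q n).2) atTop (𝓝 (loziX a b).2) :=
      (continuous_snd.tendsto _).comp hTQ
    obtain ⟨N, hN⟩ := eventually_atTop.1 (h1.eventually (Metric.ball_mem_nhds _ hX))
    have hN' : ∀ n, N ≤ n → |(Q n).1 - (loziX a b).1| < (loziX a b).1 := fun n hn => by
      simpa [Real.dist_eq] using hN n hn
    -- the component along the other eigendirection
    set l : ℕ → ℝ := fun n => ((Q n).2 - (loziX a b).2) -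
      (unstableEigenvalue a b + a) * ((Q n).1 - (loziX a b).1) with hl
    have hl0 : Tendsto l atTop (𝓝 0) := by
      have := (h2.sub_const (loziX a b).2).sub
        ((h1.sub_const (loziX a b).1).const_mul (unstableEigenvalue a b + a))
      simpa using this
    have hls : ∀ n, N ≤ n → l n = -(unstableEigenvalue a b + a) * l (n + 1) := by
      intro n hn
      have hpos : 0 ≤ (Q (n + 1)).1 := by
        have := neg_abs_le ((Q (n + 1)).1 - (loziX a b).1)
        linarith [hN' (n + 1) (by omega)]
      have e := hstep n
      rw [lozi_apply_of_nonneg hb hpos] at e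
      simp only [hl, e, loziX]
      field_simp
      linear_combination (-(1 + a - b) * (Q (n + 1)).1 + 1) * hq
    have hmu : |-(unstableEigenvalue a b + a)| ≤ 1 := by
      have e : unstableEigenvalue a b + a = b / unstableEigenvalue a b :=
        (div_unstableEigenvalue hb ha).symm
      rw [abs_le]
      constructor
      · nlinarith
      · nlinarith
    have hpow : ∀ k, |l N| ≤ |l (N + k)| := by
      intro k
      induction k with
      | zero => exact le_rfl
      | succ k ih =>
        refine ih.trans ?_
        rw [hls (N + k) (by omega), abs_mul]
        exact mul_le_of_le_one_left (abs_nonneg _) hmu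
    have hlN : l N = 0 := by
      have h3 : Tendsto (fun k => |l (N + k)|) atTop (𝓝 0) := by
        have := (hl0.comp (tendsto_add_atTop_nat N)).abs
        simp only [abs_zero] at this
        refine this.congr fun k => ?_
        simp [add_comm]
      exact abs_nonpos_iff.1 (ge_of_tendsto' h3 hpow)
    have hline : Q N = unstableLine a b ((Q N).1 - (loziX a b).1) := by
      simp only [hl] at hlN
      unfold unstableLine
      rw [div_unstableEigenvalue hb ha]
      ext
      · simp
      · simp only [Prod.snd_add, Prod.smul_mk, smul_eq_mul]
        linarith
    refine ⟨unstableEigenvalue a b ^ N * ((Q N).1 - (loziX a b).1), ?_⟩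
    have h4 := lozi_zpow_neg_unstableParam hb ha hba N
      (unstableEigenvalue a b ^ N * ((Q N).1 - (loziX a b).1))
    rw [← mul_assoc, ← mul_pow, inv_mul_cancel₀ h0, one_pow, one_mul,
      small _ (hN' N le_rfl).le, ← hline, zpow_neg, zpow_natCast,
      Equiv.Perm.inv_eq_iff_eq] at h4
    rw [h4]; exact (hQT N).symm

end ParamFacts

/-!
The unstable manifold is parametrized by the line so that the Lozi map becomes multiplication by the
unstable eigenvalue `μ < -1`; everything is read off in the parameter `t`. Near any parameter the
manifold consists of two straight branches with directions in the cone `|v| ≤ |u|`, transversal to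
the `y`-axis (`exists_hasBranch`). The Lozi map reverses or keeps the horizontal orientation of both
branches off the `y`-axis and sends both to the left on it. So the branches point to opposite sides
of the axis until the orbit first meets the axis (`crosses_of_forall_ne_zero`) and to the same side
ever after (`folds_of_fst_eq_zero`). Transversality also makes the basic points isolated, so either
side of any parameter begins in a unique basic interval; as images of basic points are basic, the
image of a basic interval contains every basic interval that it overlaps.

Given an essential admissible sequence of the point with parameter `t`, there is a side of `t` which
follows it at all times (`exists_side_of_admissible`): at the first passage through the axis the two
sides of `t` have opposite signs and either sign can be matched, while at later passages the sign is
prescribed. The basic arcs containing the images of that side form the required path.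

Conversely, the parameter intervals along a path, pulled back to time `0`, are nested and compact,
and a common point `t` has the signs of the path as an itinerary. When its orbit returns to the axis
the manifold lies on one side of the axis there, which must be the side of the basic arc
(`eventually_pos_of_hasSign`).
-/

/-! ### The parametrization of the unstable manifold -/

section Param

variable {a b : ℝ}

theorem unstableEigenvalue_ne_zero (hb : 0 < b) (ha : 1 < a) : unstableEigenvalue a b ≠ 0 := by
  linarith [unstableEigenvalue_lt hb ha]

theorem lozi_zpow_unstableParam (hb : 0 < b) (ha : 1 < a) (hba : b < a + 1) (n : ℤ) (t : ℝ) :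
    ((lozi a b hb) ^ n) (unstableParam a b hb t) =
      unstableParam a b hb (unstableEigenvalue a b ^ n * t) := by
  have h0 := unstableEigenvalue_ne_zero hb ha
  obtain ⟨k, rfl | rfl⟩ := n.eq_nat_or_neg
  · rw [zpow_natCast, zpow_natCast]
    induction k with
    | zero => simp
    | succ k ih =>
      rw [pow_succ', Equiv.Perm.mul_apply, ih, lozi_unstableParam hb ha hba, pow_succ', mul_assoc]
  · rw [lozi_zpow_neg_unstableParam hb ha hba, zpow_neg, zpow_natCast, inv_pow]

theorem unstableParam_eq_unstableLine (hb : 0 < b) (ha : 1 < a) (hba : b < a + 1) {t : ℝ}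
    (ht : |t| ≤ (loziX a b).1) : unstableParam a b hb t = unstableLine a b t := by
  rw [unstableParam_eq hb ha hba (n := 0) (by simpa using ht)]
  simp

theorem unstableParam_fst (hb : 0 < b) (ha : 1 < a) (hba : b < a + 1) {t : ℝ}
    (ht : |t| ≤ (loziX a b).1) : (unstableParam a b hb t).1 = (loziX a b).1 + t := by
  rw [unstableParam_eq_unstableLine hb ha hba ht]
  simp [unstableLine]

theorem exists_forall_abs_inv_pow_mul_lt (hb : 0 < b) (ha : 1 < a) (hba : b < a + 1) (M : ℝ) :
    ∃ N : ℕ, ∀ n, N ≤ n → ∀ t, |t| ≤ M →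
      |(unstableEigenvalue a b)⁻¹ ^ n * t| < (loziX a b).1 := by
  have h := (tendsto_pow_atTop_nhds_zero_of_lt_one (abs_nonneg _)
    (abs_inv_unstableEigenvalue hb ha)).mul_const M
  rw [zero_mul] at h
  obtain ⟨N, hN⟩ := eventually_atTop.1 (h.eventually (gt_mem_nhds (loziX_fst_pos hba)))
  refine ⟨N, fun n hn t ht => ?_⟩
  rw [abs_mul, abs_pow]
  exact (mul_le_mul_of_nonneg_left ht (by positivity)).trans_lt (hN n hn)

theorem exists_forall_unstableParam_fst_pos (hb : 0 < b) (ha : 1 < a) (hba : b < a + 1) (M : ℝ) :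
    ∃ N : ℕ, ∀ n, N ≤ n → ∀ t, |t| ≤ M →
      0 < (unstableParam a b hb ((unstableEigenvalue a b)⁻¹ ^ n * t)).1 := by
  obtain ⟨N, hN⟩ := exists_forall_abs_inv_pow_mul_lt hb ha hba M
  refine ⟨N, fun n hn t ht => ?_⟩
  have h := hN n hn t ht
  rw [unstableParam_fst hb ha hba h.le]
  linarith [neg_abs_le ((unstableEigenvalue a b)⁻¹ ^ n * t)]

end Param

/-! ### Branches of the unstable manifold at a point -/

section Branch

variable {a b : ℝ}

/-- Near the parameter `τ`, on the side given by the sign of `σ`, the unstable manifold is a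
straight segment whose direction `(u, v)` lies in the cone `|v| ≤ |u|`, and which goes to the right
if `ε > 0` and to the left if `ε < 0` (only the sign of `ε` matters; `ε = 0` is excluded). The scale
of `σ` fixes that of `(u, v)`; letting it be arbitrary makes the dynamics multiply both `σ` and `τ`
by the eigenvalue. -/
def HasBranch (a b : ℝ) (hb : 0 < b) (σ ε τ : ℝ) : Prop :=
  ∃ u v : ℝ, 0 < ε * u ∧ |v| ≤ |u| ∧ ∀ᶠ h in 𝓝[>] (0 : ℝ),
    unstableParam a b hb (τ + σ * h) = unstableParam a b hb τ + h • (u, v)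

theorem tendsto_add_mul_nhdsGT (τ σ : ℝ) :
    Tendsto (fun h : ℝ => τ + σ * h) (𝓝[>] 0) (𝓝 τ) := by
  have : Tendsto (fun h : ℝ => τ + σ * h) (𝓝 0) (𝓝 (τ + σ * 0)) :=
    (by fun_prop : Continuous fun h : ℝ => τ + σ * h).tendsto 0
  simp only [mul_zero, add_zero] at this
  exact this.mono_left nhdsWithin_le_nhds

theorem tendsto_add_mul_nhdsGT_punctured (τ : ℝ) {σ : ℝ} (hσ : σ ≠ 0) :
    Tendsto (fun h : ℝ => τ + σ * h) (𝓝[>] 0) (𝓝[≠] τ) := by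
  refine tendsto_nhdsWithin_iff.2 ⟨tendsto_add_mul_nhdsGT τ σ, ?_⟩
  filter_upwards [self_mem_nhdsWithin] with h hh
  have : h ≠ 0 := ne_of_gt hh
  simp [hσ, this]

theorem eventually_punctured_of_two_sides {q : ℝ → Prop} {t σ : ℝ} (hσ : σ ≠ 0)
    (h₁ : ∀ᶠ h in 𝓝[>] (0 : ℝ), q (t + σ * h)) (h₂ : ∀ᶠ h in 𝓝[>] (0 : ℝ), q (t + -σ * h)) :
    ∀ᶠ s in 𝓝[≠] t, q s := by
  have hc : Tendsto (fun s => |(s - t) / σ|) (𝓝[≠] t) (𝓝[>] 0) := by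
    refine tendsto_nhdsWithin_iff.2 ⟨?_, ?_⟩
    · have : Tendsto (fun s => |(s - t) / σ|) (𝓝 t) (𝓝 |(t - t) / σ|) :=
        (by fun_prop : Continuous fun s => |(s - t) / σ|).tendsto t
      simp only [sub_self, zero_div, abs_zero] at this
      exact this.mono_left nhdsWithin_le_nhds
    · filter_upwards [self_mem_nhdsWithin] with s hs
      exact abs_pos.2 (div_ne_zero (sub_ne_zero.2 hs) hσ)
  filter_upwards [hc.eventually h₁, hc.eventually h₂] with s e₁ e₂
  rcases le_total 0 ((s - t) / σ) with h | h
  · rw [abs_of_nonneg h, mul_div_cancel₀ _ hσ] at e₁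
    simpa using e₁
  · rw [abs_of_nonpos h, neg_mul_neg, mul_div_cancel₀ _ hσ] at e₂
    simpa using e₂

theorem hasBranch_of_abs_lt (hb : 0 < b) (ha : 1 < a) (hba : b ≤ a - 1) {σ τ : ℝ} (hσ : σ ≠ 0)
    (hτ : |τ| < (loziX a b).1) : HasBranch a b hb σ σ τ := by
  have hba' : b < a + 1 := by linarith
  have h1 := unstableEigenvalue_lt hb ha
  refine ⟨σ, σ * (b / unstableEigenvalue a b), mul_self_pos.2 hσ, ?_, ?_⟩
  · have e := div_unstableEigenvalue hb ha
    have h2 : b / unstableEigenvalue a b < 0 := div_neg_of_pos_of_neg hb (by linarith)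
    have h3 : -1 ≤ b / unstableEigenvalue a b := by
      rw [e]
      nlinarith [unstableEigenvalue_sq (a := a) hb]
    rw [abs_mul]
    exact mul_le_of_le_one_right (abs_nonneg _) (abs_le.2 ⟨h3, by linarith⟩)
  · have hs : ∀ᶠ h in 𝓝[>] (0 : ℝ), |τ + σ * h| < (loziX a b).1 :=
      (tendsto_add_mul_nhdsGT τ σ).abs.eventually (gt_mem_nhds hτ)
    filter_upwards [hs] with h hh
    rw [unstableParam_eq_unstableLine hb ha hba' hh.le,
      unstableParam_eq_unstableLine hb ha hba' hτ.le]
    ext <;> simp [unstableLine] <;> ring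

theorem unstableParam_eigenvalue_mul (hb : 0 < b) (ha : 1 < a) (hba : b < a + 1) (t : ℝ) :
    unstableParam a b hb (unstableEigenvalue a b * t) =
      (1 + (unstableParam a b hb t).2 - a * |(unstableParam a b hb t).1|,
        b * (unstableParam a b hb t).1) :=
  (lozi_unstableParam hb ha hba t).symm

/-- One application of the Lozi map to a branch. The slope `c` of `|x|` along the branch is `±u`,
and `b ≤ a - 1` makes the cone `|v| ≤ |u|` invariant. -/
theorem hasBranch_eigenvalue_mul (hb : 0 < b) (ha : 1 < a) (hba : b ≤ a - 1) {σ ε τ u v c : ℝ}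
    (hv : |v| ≤ |u|) (hc : |c| = |u|)
    (h : ∀ᶠ h in 𝓝[>] (0 : ℝ),
      unstableParam a b hb (τ + σ * h) = unstableParam a b hb τ + h • (u, v))
    (habs : ∀ᶠ h in 𝓝[>] (0 : ℝ),
      |(unstableParam a b hb τ).1 + h * u| = |(unstableParam a b hb τ).1| + h * c)
    (hε : 0 < ε * (v - a * c)) :
    HasBranch a b hb (unstableEigenvalue a b * σ) ε (unstableEigenvalue a b * τ) := by
  have hba' : b < a + 1 := by linarith
  refine ⟨v - a * c, b * u, hε, ?_, ?_⟩
  · have h1 : |a * c| - |v| ≤ |v - a * c| := by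
      rw [abs_sub_comm]; exact abs_sub_abs_le_abs_sub _ _
    rw [abs_mul, abs_of_pos (by linarith : 0 < a), hc] at h1
    rw [abs_mul, abs_of_pos hb]
    nlinarith [abs_nonneg u]
  · filter_upwards [h, habs] with k hk hk'
    rw [show unstableEigenvalue a b * τ + unstableEigenvalue a b * σ * k =
      unstableEigenvalue a b * (τ + σ * k) by ring, unstableParam_eigenvalue_mul hb ha hba',
      unstableParam_eigenvalue_mul hb ha hba', hk]
    ext
    · simp only [Prod.fst_add, Prod.snd_add, Prod.smul_mk, smul_eq_mul, hk']
      ring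
    · simp only [Prod.fst_add, Prod.snd_add, Prod.smul_mk, smul_eq_mul]
      ring

/-- The Lozi map folds at the `y`-axis: the images of all branches there go to the left. -/
theorem HasBranch.of_fst_eq_zero {hb : 0 < b} (ha : 1 < a) (hba : b ≤ a - 1) {σ ε τ : ℝ}
    (h : HasBranch a b hb σ ε τ) (h0 : (unstableParam a b hb τ).1 = 0) :
    HasBranch a b hb (unstableEigenvalue a b * σ) (-1) (unstableEigenvalue a b * τ) := by
  obtain ⟨u, v, hu, hv, he⟩ := h
  refine hasBranch_eigenvalue_mul hb ha hba hv (abs_abs u) he ?_ ?_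
  · filter_upwards [self_mem_nhdsWithin] with k hk
    rw [h0, zero_add, abs_zero, zero_add, abs_mul, abs_of_pos hk]
  · have : 0 < |u| := abs_pos.2 (right_ne_zero_of_mul hu.ne')
    nlinarith [le_abs_self v]

/-- Off the `y`-axis, the Lozi map keeps the horizontal orientation of branches if `x < 0`
and reverses it if `x > 0`. -/
theorem HasBranch.of_fst_ne_zero {hb : 0 < b} (ha : 1 < a) (hba : b ≤ a - 1) {σ ε τ : ℝ}
    (h : HasBranch a b hb σ ε τ) (h0 : (unstableParam a b hb τ).1 ≠ 0) :
    HasBranch a b hb (unstableEigenvalue a b * σ) (-(unstableParam a b hb τ).1 * ε)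
      (unstableEigenvalue a b * τ) := by
  obtain ⟨u, v, hu, hv, he⟩ := h
  have ht := tendsto_add_mul_nhdsGT (unstableParam a b hb τ).1 u
  have hεv : |ε * v| ≤ ε * u := by
    rw [← abs_of_pos hu, abs_mul, abs_mul]
    exact mul_le_mul_of_nonneg_left hv (abs_nonneg _)
  have hεv' := abs_le.1 hεv
  rcases h0.lt_or_gt with hn | hp
  · refine hasBranch_eigenvalue_mul hb ha hba hv (abs_neg u) he ?_ ?_
    · filter_upwards [ht.eventually (gt_mem_nhds hn)] with k hk
      rw [mul_comm k u, abs_of_neg hk, abs_of_neg hn]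
      ring
    · have : 0 < ε * v + a * (ε * u) := by nlinarith
      have := mul_pos (neg_pos.2 hn) this
      linarith
  · refine hasBranch_eigenvalue_mul hb ha hba hv rfl he ?_ ?_
    · filter_upwards [ht.eventually (lt_mem_nhds hp)] with k hk
      rw [mul_comm k u, abs_of_pos hk, abs_of_pos hp]
    · have : 0 < a * (ε * u) - ε * v := by nlinarith
      have := mul_pos hp this
      linarith

theorem HasBranch.eventually_fst_ne_zero {hb : 0 < b} {σ ε τ : ℝ} (h : HasBranch a b hb σ ε τ) :
    ∀ᶠ k in 𝓝[>] (0 : ℝ), (unstableParam a b hb (τ + σ * k)).1 ≠ 0 := by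
  obtain ⟨u, v, hu, -, he⟩ := h
  have hu0 : u ≠ 0 := right_ne_zero_of_mul hu.ne'
  by_cases h0 : (unstableParam a b hb τ).1 = 0
  · filter_upwards [he, self_mem_nhdsWithin] with k hk hk0
    have : k ≠ 0 := ne_of_gt hk0
    simp [hk, h0, hu0, this]
  · filter_upwards [he, (tendsto_add_mul_nhdsGT _ u).eventually
      (isOpen_ne.mem_nhds h0)] with k hk hk'
    simpa [hk, mul_comm] using hk'

theorem HasBranch.eventually_pos {hb : 0 < b} {σ ε τ : ℝ} (h : HasBranch a b hb σ ε τ)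
    (h0 : (unstableParam a b hb τ).1 = 0) :
    ∀ᶠ k in 𝓝[>] (0 : ℝ), 0 < ε * (unstableParam a b hb (τ + σ * k)).1 := by
  obtain ⟨u, v, hu, -, he⟩ := h
  filter_upwards [he, self_mem_nhdsWithin] with k hk hk0
  have := mul_pos hu hk0
  simp only [hk, h0, Prod.fst_add, Prod.smul_mk, smul_eq_mul]
  linarith

/-- The two branches at `τ` go to opposite sides. -/
def Crosses (a b : ℝ) (hb : 0 < b) (τ : ℝ) : Prop :=
  ∀ σ : ℝ, σ ≠ 0 → ∃ ε : ℝ, ε ≠ 0 ∧ HasBranch a b hb σ ε τ ∧ HasBranch a b hb (-σ) (-ε) τ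

/-- The two branches at `τ` go to the same side. -/
def Folds (a b : ℝ) (hb : 0 < b) (τ : ℝ) : Prop :=
  ∀ σ : ℝ, σ ≠ 0 → ∃ ε : ℝ, ε ≠ 0 ∧ HasBranch a b hb σ ε τ ∧ HasBranch a b hb (-σ) ε τ

theorem Crosses.of_fst_ne_zero {hb : 0 < b} (ha : 1 < a) (hba : b ≤ a - 1) {τ : ℝ}
    (h : Crosses a b hb τ) (h0 : (unstableParam a b hb τ).1 ≠ 0) :
    Crosses a b hb (unstableEigenvalue a b * τ) := by
  intro σ hσ
  have hμ := unstableEigenvalue_ne_zero hb ha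
  obtain ⟨ε, hε, h1, h2⟩ := h (σ / unstableEigenvalue a b) (div_ne_zero hσ hμ)
  refine ⟨_, mul_ne_zero (neg_ne_zero.2 h0) hε, ?_, ?_⟩
  · simpa only [mul_div_cancel₀ _ hμ] using h1.of_fst_ne_zero ha hba h0
  · simpa only [mul_neg, mul_div_cancel₀ _ hμ] using h2.of_fst_ne_zero ha hba h0

theorem Folds.of_fst_ne_zero {hb : 0 < b} (ha : 1 < a) (hba : b ≤ a - 1) {τ : ℝ}
    (h : Folds a b hb τ) (h0 : (unstableParam a b hb τ).1 ≠ 0) :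
    Folds a b hb (unstableEigenvalue a b * τ) := by
  intro σ hσ
  have hμ := unstableEigenvalue_ne_zero hb ha
  obtain ⟨ε, hε, h1, h2⟩ := h (σ / unstableEigenvalue a b) (div_ne_zero hσ hμ)
  refine ⟨_, mul_ne_zero (neg_ne_zero.2 h0) hε, ?_, ?_⟩
  · simpa only [mul_div_cancel₀ _ hμ] using h1.of_fst_ne_zero ha hba h0
  · simpa only [mul_neg, mul_div_cancel₀ _ hμ] using h2.of_fst_ne_zero ha hba h0

theorem crosses_of_abs_lt (hb : 0 < b) (ha : 1 < a) (hba : b ≤ a - 1) {τ : ℝ}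
    (hτ : |τ| < (loziX a b).1) : Crosses a b hb τ := fun σ hσ =>
  ⟨σ, hσ, hasBranch_of_abs_lt hb ha hba hσ hτ,
    hasBranch_of_abs_lt hb ha hba (neg_ne_zero.2 hσ) hτ⟩

/-- Branches exist everywhere, by pulling back to the vicinity of the fixed point. -/
theorem exists_hasBranch (hb : 0 < b) (ha : 1 < a) (hba : b ≤ a - 1) {σ : ℝ} (hσ : σ ≠ 0)
    (τ : ℝ) : ∃ ε, HasBranch a b hb σ ε τ := by
  have hμ := unstableEigenvalue_ne_zero hb ha
  obtain ⟨N, hN⟩ := exists_forall_abs_inv_pow_mul_lt hb ha (by linarith : b < a + 1) |τ|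
  have key : ∀ n : ℕ, ∀ t, |t| < (loziX a b).1 → ∀ σ, σ ≠ 0 →
      ∃ ε, HasBranch a b hb σ ε (unstableEigenvalue a b ^ n * t) := by
    intro n t ht
    induction n with
    | zero =>
      intro σ hσ
      exact ⟨σ, by simpa using hasBranch_of_abs_lt hb ha hba hσ ht⟩
    | succ n ih =>
      intro σ hσ
      obtain ⟨ε, h⟩ := ih _ (div_ne_zero hσ hμ)
      rw [pow_succ', mul_assoc, ← mul_div_cancel₀ σ hμ]
      by_cases h0 : (unstableParam a b hb (unstableEigenvalue a b ^ n * t)).1 = 0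
      · exact ⟨_, h.of_fst_eq_zero ha hba h0⟩
      · exact ⟨_, h.of_fst_ne_zero ha hba h0⟩
  obtain ⟨ε, h⟩ := key N _ (hN N le_rfl τ le_rfl) σ hσ
  refine ⟨ε, ?_⟩
  rwa [← mul_assoc, ← mul_pow, mul_inv_cancel₀ hμ, one_pow, one_mul] at h

theorem crosses_of_forall_ne_zero (hb : 0 < b) (ha : 1 < a) (hba : b ≤ a - 1) {τ : ℝ}
    (h : ∀ k : ℕ, 1 ≤ k → (unstableParam a b hb ((unstableEigenvalue a b)⁻¹ ^ k * τ)).1 ≠ 0) :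
    Crosses a b hb τ := by
  have hμ := unstableEigenvalue_ne_zero hb ha
  obtain ⟨N, hN⟩ := exists_forall_abs_inv_pow_mul_lt hb ha (by linarith : b < a + 1) |τ|
  have key : ∀ n : ℕ, n ≤ N →
      Crosses a b hb ((unstableEigenvalue a b)⁻¹ ^ (N - n) * τ) := by
    intro n hn
    induction n with
    | zero => exact crosses_of_abs_lt hb ha hba (hN N le_rfl τ le_rfl)
    | succ n ih =>
      have h1 := (ih (by omega)).of_fst_ne_zero ha hba (h _ (by omega))
      rwa [show N - n = (N - (n + 1)) + 1 by omega, pow_succ', ← mul_assoc, ← mul_assoc,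
        mul_inv_cancel₀ hμ, one_mul] at h1
  simpa using key N le_rfl

theorem folds_of_fst_eq_zero (hb : 0 < b) (ha : 1 < a) (hba : b ≤ a - 1) {τ : ℝ}
    (h : (unstableParam a b hb τ).1 = 0) (n : ℕ) :
    Folds a b hb (unstableEigenvalue a b ^ (n + 1) * τ) := by
  have hμ := unstableEigenvalue_ne_zero hb ha
  have key : ∀ τ, (unstableParam a b hb τ).1 = 0 →
      Folds a b hb (unstableEigenvalue a b * τ) := by
    intro τ h σ hσ
    obtain ⟨ε₁, h₁⟩ := exists_hasBranch hb ha hba (div_ne_zero hσ hμ) τ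
    obtain ⟨ε₂, h₂⟩ := exists_hasBranch hb ha hba (neg_ne_zero.2 (div_ne_zero hσ hμ)) τ
    refine ⟨-1, by norm_num, ?_, ?_⟩
    · simpa only [mul_div_cancel₀ _ hμ] using h₁.of_fst_eq_zero ha hba h
    · simpa only [mul_neg, mul_div_cancel₀ _ hμ] using h₂.of_fst_eq_zero ha hba h
  induction n with
  | zero => simpa using key τ h
  | succ n ih =>
    rw [pow_succ', mul_assoc]
    by_cases h0 : (unstableParam a b hb (unstableEigenvalue a b ^ (n + 1) * τ)).1 = 0
    · exact key _ h0
    · exact ih.of_fst_ne_zero ha hba h0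

end Branch

/-! ### Basic points and basic arcs in the parametrization -/

section Basic

variable {a b : ℝ}

/-- The parameters of the points of `W^u_X` that are on the `y`-axis or have some backward image
there. They turn out to be the parameters of the basic points. -/
def basicParams (a b : ℝ) (hb : 0 < b) : Set ℝ :=
  {t | ∃ j : ℕ, (unstableParam a b hb ((unstableEigenvalue a b)⁻¹ ^ j * t)).1 = 0}

/-- Every orbit meeting the `y`-axis does so for a first time, so that a forward image of a point of
the `y`-axis is also a forward image of a gluing point. -/
theorem unstableParam_mem_basicPoints_iff (hb : 0 < b) (ha : 1 < a) (hba : b < a + 1) {t : ℝ} :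
    unstableParam a b hb t ∈ basicPoints a b hb ↔ t ∈ basicParams a b hb := by
  have hμ := unstableEigenvalue_ne_zero hb ha
  constructor
  · rintro ⟨G, ⟨hG, hG0, -⟩, j, hj⟩
    rw [← range_unstableParam hb ha hba] at hG
    obtain ⟨g, rfl⟩ := hG
    rw [← zpow_natCast, lozi_zpow_unstableParam hb ha hba, zpow_natCast] at hj
    refine ⟨j, ?_⟩
    rw [injective_unstableParam hb ha hba hj, ← mul_assoc, ← mul_pow, inv_mul_cancel₀ hμ, one_pow,
      one_mul]
    exact hG0
  · rintro ⟨j, hj⟩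
    obtain ⟨N, hN⟩ := exists_forall_unstableParam_fst_pos hb ha hba |t|
    let q : ℕ → Prop := fun k =>
      (unstableParam a b hb ((unstableEigenvalue a b)⁻¹ ^ k * t)).1 = 0
    classical
    have hbd : ∀ k, q k → k ≤ N := fun k hk => by
      by_contra hlt
      exact (hN k (by omega) t le_rfl).ne' hk
    have hm : q (Nat.findGreatest q N) := Nat.findGreatest_spec (hbd j hj) hj
    have hmax : ∀ k, Nat.findGreatest q N < k → ¬ q k := fun k hk hqk =>
      Nat.findGreatest_is_greatest hk (hbd k hqk) hqk
    generalize Nat.findGreatest q N = m at hm hmax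
    refine ⟨unstableParam a b hb ((unstableEigenvalue a b)⁻¹ ^ m * t), ⟨?_, hm, ?_⟩, m, ?_⟩
    · rw [← range_unstableParam hb ha hba]
      exact mem_range_self _
    · intro k hk
      rw [lozi_zpow_neg_unstableParam hb ha hba, ← mul_assoc, ← pow_add]
      exact hmax _ (by omega)
    · rw [← zpow_natCast, lozi_zpow_unstableParam hb ha hba, zpow_natCast, ← mul_assoc, ← mul_pow,
        mul_inv_cancel₀ hμ, one_pow, one_mul]

theorem mem_basicParams_of_fst_eq_zero {hb : 0 < b} {t : ℝ} (h : (unstableParam a b hb t).1 = 0) :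
    t ∈ basicParams a b hb := ⟨0, by simpa using h⟩

theorem eigenvalue_mul_mem_basicParams {hb : 0 < b} (ha : 1 < a) {t : ℝ}
    (h : t ∈ basicParams a b hb) : unstableEigenvalue a b * t ∈ basicParams a b hb := by
  have hμ := unstableEigenvalue_ne_zero hb ha
  obtain ⟨j, hj⟩ := h
  refine ⟨j + 1, ?_⟩
  rwa [pow_succ, mul_assoc, inv_mul_cancel_left₀ hμ]

theorem eventually_fst_ne_zero (hb : 0 < b) (ha : 1 < a) (hba : b ≤ a - 1) (t : ℝ) :
    ∀ᶠ s in 𝓝[≠] t, (unstableParam a b hb s).1 ≠ 0 := by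
  obtain ⟨ε₁, h₁⟩ := exists_hasBranch hb ha hba one_ne_zero t
  obtain ⟨ε₂, h₂⟩ := exists_hasBranch hb ha hba (neg_ne_zero.2 one_ne_zero) t
  exact eventually_punctured_of_two_sides one_ne_zero h₁.eventually_fst_ne_zero
    h₂.eventually_fst_ne_zero

/-- Basic points are isolated: branches are transversal to the `y`-axis, and only finitely many
iterates come into play on a bounded set of parameters. -/
theorem eventually_notMem_basicParams (hb : 0 < b) (ha : 1 < a) (hba : b ≤ a - 1) (t : ℝ) :
    ∀ᶠ s in 𝓝[≠] t, s ∉ basicParams a b hb := by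
  have hμ := unstableEigenvalue_ne_zero hb ha
  obtain ⟨N, hN⟩ := exists_forall_unstableParam_fst_pos hb ha (by linarith : b < a + 1) (|t| + 1)
  have h1 : ∀ᶠ s in 𝓝[≠] t, ∀ j ∈ Finset.range N,
      (unstableParam a b hb ((unstableEigenvalue a b)⁻¹ ^ j * s)).1 ≠ 0 := by
    rw [Filter.eventually_all_finset]
    intro j _
    have hc : (unstableEigenvalue a b)⁻¹ ^ j ≠ 0 := pow_ne_zero _ (inv_ne_zero hμ)
    have ht : Tendsto (fun s => (unstableEigenvalue a b)⁻¹ ^ j * s) (𝓝[≠] t)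
        (𝓝[≠] ((unstableEigenvalue a b)⁻¹ ^ j * t)) := by
      refine tendsto_nhdsWithin_iff.2 ⟨?_, ?_⟩
      · exact ((continuous_const_mul _).tendsto t).mono_left nhdsWithin_le_nhds
      · filter_upwards [self_mem_nhdsWithin] with s hs
        simpa [hc, hμ] using hs
    exact ht.eventually (eventually_fst_ne_zero hb ha hba _)
  have h2 : ∀ᶠ s in 𝓝[≠] t, |s| < |t| + 1 :=
    ((continuous_abs.tendsto t).mono_left nhdsWithin_le_nhds).eventually
      (gt_mem_nhds (by linarith))
  filter_upwards [h1, h2] with s hs hs' hsE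
  obtain ⟨j, hj⟩ := hsE
  by_cases hjN : j < N
  · exact hs j (Finset.mem_range.2 hjN) hj
  · exact (hN j (by omega) s hs'.le).ne' hj

theorem isClosed_basicParams (hb : 0 < b) (ha : 1 < a) (hba : b ≤ a - 1) :
    IsClosed (basicParams a b hb) := by
  rw [← isOpen_compl_iff, isOpen_iff_mem_nhds]
  intro t ht
  have h := eventually_notMem_basicParams hb ha hba t
  rw [eventually_nhdsWithin_iff] at h
  filter_upwards [h] with s hs
  by_cases hst : s = t
  · rwa [hst]
  · exact hs hst

/-- Basic points lie arbitrarily far out on both sides of the fixed point: the parameter `-X.1` is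
on the `y`-axis, and the eigenvalue is less than `-1`. -/
theorem exists_mem_basicParams (hb : 0 < b) (ha : 1 < a) (hba : b < a + 1) (M : ℝ) :
    (∃ e ∈ basicParams a b hb, M < e) ∧ ∃ e ∈ basicParams a b hb, e < -M := by
  have h1 := unstableEigenvalue_lt hb ha
  have hX := loziX_fst_pos hba
  have hmem : ∀ n : ℕ, unstableEigenvalue a b ^ n * (-(loziX a b).1) ∈ basicParams a b hb := by
    intro n
    induction n with
    | zero =>
      apply mem_basicParams_of_fst_eq_zero
      rw [pow_zero, one_mul, unstableParam_fst hb ha hba (by rw [abs_neg, abs_of_pos hX])]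
      ring
    | succ n ih =>
      rw [pow_succ', mul_assoc]
      exact eigenvalue_mul_mem_basicParams ha ih
  obtain ⟨n, hn⟩ := pow_unbounded_of_one_lt (|M| / (loziX a b).1)
    (by rw [abs_of_neg (by linarith)]; linarith : 1 < |unstableEigenvalue a b|)
  rw [div_lt_iff₀ hX, ← abs_pow] at hn
  have hm := hmem n
  have hlt : |M| < |unstableEigenvalue a b ^ n * (-(loziX a b).1)| := by
    rwa [abs_mul, abs_neg, abs_of_pos hX]
  generalize unstableEigenvalue a b ^ n * (-(loziX a b).1) = e at hm hlt
  have hm' := eigenvalue_mul_mem_basicParams ha hm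
  have hM := neg_abs_le M
  have hM' := le_abs_self M
  rcases le_total 0 e with he | he
  · rw [abs_of_nonneg he] at hlt
    exact ⟨⟨e, hm, by linarith⟩, _, hm', by nlinarith⟩
  · rw [abs_of_nonpos he] at hlt
    exact ⟨⟨_, hm', by nlinarith⟩, e, hm, by linarith⟩

/-- `[s, e]` is the parameter interval of a basic arc. -/
def IsBasicInterval (a b : ℝ) (hb : 0 < b) (s e : ℝ) : Prop :=
  s < e ∧ s ∈ basicParams a b hb ∧ e ∈ basicParams a b hb ∧
    ∀ u ∈ Ioo s e, u ∉ basicParams a b hb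

theorem isBasicArc_iff (hb : 0 < b) (ha : 1 < a) (hba : b < a + 1) {B : Set (ℝ × ℝ)} :
    IsBasicArc a b hb B ↔
      ∃ s e, IsBasicInterval a b hb s e ∧ B = unstableParam a b hb '' Icc s e := by
  simp only [IsBasicArc, IsBasicInterval, unstableParam_mem_basicPoints_iff hb ha hba, and_assoc]

theorem exists_isBasicInterval_of_notMem (hb : 0 < b) (ha : 1 < a) (hba : b ≤ a - 1) {c : ℝ}
    (hc : c ∉ basicParams a b hb) : ∃ s e, IsBasicInterval a b hb s e ∧ c ∈ Ioo s e := by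
  have hcl := isClosed_basicParams hb ha hba
  have hba' : b < a + 1 := by linarith
  obtain ⟨e₀, he₀, hce₀⟩ := (exists_mem_basicParams hb ha hba' c).1
  obtain ⟨s₀, hs₀, hcs₀⟩ := (exists_mem_basicParams hb ha hba' (-c)).2
  rw [neg_neg] at hcs₀
  have hbs : BddAbove (basicParams a b hb ∩ Iic c) := ⟨c, fun x hx => hx.2⟩
  have hbe : BddBelow (basicParams a b hb ∩ Ici c) := ⟨c, fun x hx => hx.2⟩
  have hs := (hcl.inter isClosed_Iic).csSup_mem ⟨s₀, hs₀, hcs₀.le⟩ hbs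
  have he := (hcl.inter isClosed_Ici).csInf_mem ⟨e₀, he₀, hce₀.le⟩ hbe
  have hs' := lt_of_le_of_ne (mem_Iic.1 hs.2) fun h => hc (h ▸ hs.1)
  have he' := lt_of_le_of_ne (mem_Ici.1 he.2) fun h => hc (h.symm ▸ he.1)
  refine ⟨_, _, ⟨hs'.trans he', hs.1, he.1, fun u hu huE => ?_⟩, hs', he'⟩
  rcases le_total u c with h | h
  · exact (le_csSup hbs ⟨huE, h⟩).not_gt hu.1
  · exact (csInf_le hbe ⟨huE, h⟩).not_gt hu.2

/-- On either side of a parameter `t`, basic or not, a basic interval starts or continues. -/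
theorem exists_isBasicInterval (hb : 0 < b) (ha : 1 < a) (hba : b ≤ a - 1) (t : ℝ) {σ : ℝ}
    (hσ : σ ≠ 0) : ∃ s e, IsBasicInterval a b hb s e ∧
      ∀ᶠ h in 𝓝[>] (0 : ℝ), t + σ * h ∈ Ioo s e := by
  have hev := (tendsto_add_mul_nhdsGT_punctured t hσ).eventually
    (eventually_notMem_basicParams hb ha hba t)
  obtain ⟨r, hr, hrE⟩ := mem_nhdsGT_iff_exists_Ioc_subset.1 hev
  have hr0 : (0 : ℝ) < r := hr
  obtain ⟨s, e, hI, hc⟩ := exists_isBasicInterval_of_notMem hb ha hba (hrE ⟨hr0, le_rfl⟩)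
  refine ⟨s, e, hI, ?_⟩
  -- a basic parameter between `t + σ h` and `t + σ r` is `t + σ k` for some `k` in `[h, r]`
  have key : ∀ h ∈ Ioo 0 r, ∀ x ∈ basicParams a b hb, x ∉ uIcc (t + σ * h) (t + σ * r) := by
    intro h hh x hx hxu
    have hk : (x - t) / σ ∈ Icc h r := by
      rcases hσ.lt_or_gt with hn | hp
      · rw [uIcc_of_ge (by nlinarith [hh.2])] at hxu
        exact ⟨by rw [le_div_iff_of_neg hn]; linarith [hxu.2],
          by rw [div_le_iff_of_neg hn]; linarith [hxu.1]⟩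
      · rw [uIcc_of_le (by nlinarith [hh.2])] at hxu
        exact ⟨by rw [le_div_iff₀ hp]; linarith [hxu.1],
          by rw [div_le_iff₀ hp]; linarith [hxu.2]⟩
    have h2 := hrE ⟨hh.1.trans_le hk.1, hk.2⟩
    simp only [mem_ofPred_eq, mul_div_cancel₀ _ hσ, add_sub_cancel] at h2
    exact h2 hx
  filter_upwards [Ioo_mem_nhdsGT hr0] with h hh
  refine ⟨lt_of_not_ge fun hle => ?_, lt_of_not_ge fun hle => ?_⟩
  · exact key h hh s hI.2.1 (mem_uIcc.2 (Or.inl ⟨hle, hc.1.le⟩))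
  · exact key h hh e hI.2.2.1 (mem_uIcc.2 (Or.inr ⟨hc.2.le, hle⟩))

/-- The image of a basic interval is a union of basic intervals, since the image of a basic point is
basic; so it contains each basic interval that it overlaps. -/
theorem IsBasicInterval.image_subset {hb : 0 < b} (ha : 1 < a) (hba : b < a + 1) {s e s' e' c : ℝ}
    (h : IsBasicInterval a b hb s e) (h' : IsBasicInterval a b hb s' e') (hc : c ∈ Ioo s e)
    (hc' : unstableEigenvalue a b * c ∈ Ioo s' e') :
    unstableParam a b hb '' Icc s' e' ⊆ lozi a b hb '' (unstableParam a b hb '' Icc s e) := by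
  have h1 := unstableEigenvalue_lt hb ha
  have hμ : unstableEigenvalue a b < 0 := by linarith
  have hs : e' ≤ unstableEigenvalue a b * s := by
    by_contra hlt
    refine h'.2.2.2 _ ⟨?_, not_le.1 hlt⟩ (eigenvalue_mul_mem_basicParams ha h.2.1)
    exact hc'.1.trans (mul_lt_mul_of_neg_left hc.1 hμ)
  have he : unstableEigenvalue a b * e ≤ s' := by
    by_contra hlt
    refine h'.2.2.2 _ ⟨not_le.1 hlt, ?_⟩ (eigenvalue_mul_mem_basicParams ha h.2.2.1)
    exact (mul_lt_mul_of_neg_left hc.2 hμ).trans hc'.2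
  rintro _ ⟨y, hy, rfl⟩
  refine ⟨_, ⟨y / unstableEigenvalue a b, ⟨?_, ?_⟩, rfl⟩, ?_⟩
  · rw [le_div_iff_of_neg hμ]; linarith [hy.2]
  · rw [div_le_iff_of_neg hμ]; linarith [hy.1]
  · rw [lozi_unstableParam hb ha hba, mul_div_cancel₀ _ hμ.ne]

/-- A basic arc does not cross the `y`-axis, so one interior point off the axis determines
its sign. -/
theorem IsBasicInterval.hasSign {hb : 0 < b} (ha : 1 < a) (hba : b < a + 1) {s e c : ℝ}
    (h : IsBasicInterval a b hb s e) (hc : c ∈ Ioo s e) {p : ℤˣ}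
    (hp : 0 < ((p : ℤ) : ℝ) * (unstableParam a b hb c).1) :
    HasSign (unstableParam a b hb '' Icc s e) p := by
  rintro _ ⟨y, hy, rfl⟩
  by_contra! hlt
  have hcont : Continuous fun x => ((p : ℤ) : ℝ) * (unstableParam a b hb x).1 :=
    continuous_const.mul (continuous_fst.comp (continuous_unstableParam hb ha hba))
  obtain ⟨z, hz, hz0⟩ := intermediate_value_uIcc (hcont.continuousOn (s := uIcc y c))
    (mem_uIcc.2 (Or.inl ⟨hlt.le, hp.le⟩))
  have hz0' : ((p : ℤ) : ℝ) * (unstableParam a b hb z).1 = 0 := hz0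
  have hzy : z ≠ y := fun e => by rw [e] at hz0'; exact hlt.ne hz0'
  refine h.2.2.2 z ?_ (mem_basicParams_of_fst_eq_zero
    ((mul_eq_zero.1 hz0').resolve_left (left_ne_zero_of_mul hp.ne')))
  rcases mem_uIcc.1 hz with hz | hz
  · exact ⟨hy.1.trans_lt (lt_of_le_of_ne hz.1 hzy.symm), hz.2.trans_lt hc.2⟩
  · exact ⟨hc.1.trans_le hz.1, (lt_of_le_of_ne hz.2 hzy).trans_le hy.2⟩

end Basic

/-! ### Admissible sequences and sign-paths -/

section Main

variable {a b : ℝ}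

theorem intUnits_cast_ne_zero (p : ℤˣ) : ((p : ℤ) : ℝ) ≠ 0 := Int.cast_ne_zero.2 p.ne_zero

theorem mul_pos_of_mul_pos_of_mul_pos {x y z : ℝ} (hxy : 0 < x * y) (hyz : 0 < y * z) :
    0 < x * z := by
  have h : 0 < x * z * (y * y) := by linarith [mul_pos hxy hyz]
  exact pos_of_mul_pos_left h (mul_self_nonneg y)

/-- The first passage of an orbit of `W^u_X` through the `y`-axis. -/
theorem exists_first_fst_eq_zero (hb : 0 < b) (ha : 1 < a) (hba : b < a + 1) {t : ℝ}
    (h : ∃ n : ℤ, (unstableParam a b hb (unstableEigenvalue a b ^ n * t)).1 = 0) :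
    ∃ m : ℤ, (unstableParam a b hb (unstableEigenvalue a b ^ m * t)).1 = 0 ∧
      ∀ n : ℤ, (unstableParam a b hb (unstableEigenvalue a b ^ n * t)).1 = 0 → m ≤ n := by
  obtain ⟨N, hN⟩ := exists_forall_unstableParam_fst_pos hb ha hba |t|
  refine Int.exists_least_of_bdd ⟨-(N : ℤ), fun n hn => ?_⟩ h
  by_contra hlt
  have h1 := hN (-n).toNat (by omega) t le_rfl
  rw [inv_pow, ← zpow_natCast, ← zpow_neg, Int.toNat_of_nonneg (by omega), neg_neg] at h1
  exact h1.ne' hn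

/-- One side `σ` of `t` follows an essential admissible sequence at all times: at the first passage
through the `y`-axis the two sides of `t` get opposite signs, and either sign can be matched; at the
later passages the sign is prescribed. -/
theorem exists_side_of_admissible (hb : 0 < b) (ha : 1 < a) (hba : b ≤ a - 1) {p : ℤ → ℤˣ} {t : ℝ}
    (hit : ∀ n : ℤ,
      0 ≤ ((p n : ℤ) : ℝ) * (unstableParam a b hb (unstableEigenvalue a b ^ n * t)).1)
    (hess : ∀ k l : ℤ, k < l → (unstableParam a b hb (unstableEigenvalue a b ^ k * t)).1 = 0 →
      (unstableParam a b hb (unstableEigenvalue a b ^ l * t)).1 = 0 →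
      ∀ᶠ s in 𝓝[≠] t,
        0 < ((p l : ℤ) : ℝ) * (unstableParam a b hb (unstableEigenvalue a b ^ l * s)).1) :
    ∃ σ : ℝ, σ ≠ 0 ∧ ∀ n : ℤ, ∀ᶠ h in 𝓝[>] (0 : ℝ), 0 < ((p n : ℤ) : ℝ) *
      (unstableParam a b hb (unstableEigenvalue a b ^ n * (t + σ * h))).1 := by
  have hba' : b < a + 1 := by linarith
  have hμ := unstableEigenvalue_ne_zero hb ha
  -- times at which the orbit is off the axis impose nothing
  have hoff : ∀ σ : ℝ, ∀ n : ℤ,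
      (unstableParam a b hb (unstableEigenvalue a b ^ n * t)).1 ≠ 0 →
      ∀ᶠ h in 𝓝[>] (0 : ℝ), 0 < ((p n : ℤ) : ℝ) *
        (unstableParam a b hb (unstableEigenvalue a b ^ n * (t + σ * h))).1 := by
    intro σ n hn
    have hc : Continuous fun s => ((p n : ℤ) : ℝ) *
        (unstableParam a b hb (unstableEigenvalue a b ^ n * s)).1 :=
      continuous_const.mul (continuous_fst.comp
        ((continuous_unstableParam hb ha hba').comp (continuous_const_mul _)))
    exact ((hc.tendsto t).comp (tendsto_add_mul_nhdsGT t σ)).eventually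
      (lt_mem_nhds (lt_of_le_of_ne (hit n) (mul_ne_zero (intUnits_cast_ne_zero _) hn).symm))
  by_cases hex : ∃ n : ℤ, (unstableParam a b hb (unstableEigenvalue a b ^ n * t)).1 = 0
  · obtain ⟨m, hm, hmin⟩ := exists_first_fst_eq_zero hb ha hba' hex
    have hcross : Crosses a b hb (unstableEigenvalue a b ^ m * t) := by
      refine crosses_of_forall_ne_zero hb ha hba fun k hk h0 => ?_
      rw [inv_pow, ← zpow_natCast, ← zpow_neg, ← mul_assoc, ← zpow_add₀ hμ] at h0
      have := hmin _ h0
      omega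
    have hσ : ∃ σ : ℝ, σ ≠ 0 ∧ ∀ᶠ h in 𝓝[>] (0 : ℝ), 0 < ((p m : ℤ) : ℝ) *
        (unstableParam a b hb (unstableEigenvalue a b ^ m * (t + σ * h))).1 := by
      have hside : ∀ σ ε : ℝ, HasBranch a b hb (unstableEigenvalue a b ^ m * σ) ε
          (unstableEigenvalue a b ^ m * t) → 0 < ((p m : ℤ) : ℝ) * ε →
          ∀ᶠ h in 𝓝[>] (0 : ℝ), 0 < ((p m : ℤ) : ℝ) *
            (unstableParam a b hb (unstableEigenvalue a b ^ m * (t + σ * h))).1 := by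
        intro σ ε h1 h2
        filter_upwards [h1.eventually_pos hm] with h hh
        rw [mul_add, ← mul_assoc]
        exact mul_pos_of_mul_pos_of_mul_pos h2 hh
      obtain ⟨ε, hε, h1, h2⟩ := hcross (unstableEigenvalue a b ^ m * 1)
        (mul_ne_zero (zpow_ne_zero _ hμ) one_ne_zero)
      rw [← mul_neg] at h2
      rcases (mul_ne_zero (intUnits_cast_ne_zero (p m)) hε).lt_or_gt with hn | hp
      · exact ⟨-1, by norm_num, hside _ _ h2 (by linarith)⟩
      · exact ⟨1, one_ne_zero, hside _ _ h1 hp⟩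
    obtain ⟨σ, hσ0, hσm⟩ := hσ
    refine ⟨σ, hσ0, fun n => ?_⟩
    by_cases hn : (unstableParam a b hb (unstableEigenvalue a b ^ n * t)).1 = 0
    · rcases (hmin n hn).eq_or_lt with rfl | hlt
      · exact hσm
      · exact (tendsto_add_mul_nhdsGT_punctured t hσ0).eventually (hess m n hlt hm hn)
    · exact hoff σ n hn
  · exact ⟨1, one_ne_zero, fun n => hoff 1 n fun h => hex ⟨n, h⟩⟩

theorem isSignPath_of_isEssentialRAdmissible (hb : 0 < b) (ha : 1 < a) (hba : b ≤ a - 1)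
    {p : ℤ → ℤˣ} (hp : IsEssentialRAdmissible a b hb p) : IsSignPath a b hb p := by
  have hba' : b < a + 1 := by linarith
  have hμ := unstableEigenvalue_ne_zero hb ha
  obtain ⟨_, -, hit, t, rfl, hess⟩ := hp
  simp only [IsItinerary, lozi_zpow_unstableParam hb ha hba'] at hit hess
  obtain ⟨σ, hσ, hside⟩ := exists_side_of_admissible hb ha hba hit hess
  -- the path consists of the basic arcs that contain the orbit of the chosen side of `t`
  choose s e hI hmem using fun n : ℤ => exists_isBasicInterval hb ha hba
    (unstableEigenvalue a b ^ n * t) (mul_ne_zero (zpow_ne_zero n hμ) hσ)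
  have hmem' : ∀ n, ∀ᶠ h in 𝓝[>] (0 : ℝ),
      unstableEigenvalue a b ^ n * (t + σ * h) ∈ Ioo (s n) (e n) := fun n => by
    simpa only [mul_add, mul_assoc] using hmem n
  refine ⟨fun n => ⟨unstableParam a b hb '' Icc (s n) (e n),
    (isBasicArc_iff hb ha hba').2 ⟨s n, e n, hI n, rfl⟩⟩, fun n => ?_, fun n => ?_⟩
  · obtain ⟨h, h1, h2⟩ := ((hmem' n).and (hmem' (n + 1))).exists
    rw [add_comm, zpow_one_add₀ hμ, mul_assoc, add_comm] at h2
    exact (hI n).image_subset ha hba' (hI (n + 1)) h1 h2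
  · obtain ⟨h, h1, h2⟩ := ((hmem' n).and (hside n)).exists
    exact (hI n).hasSign ha hba' h1 h2

/-- At a return to the `y`-axis both sides of the unstable manifold lie on the same side of the axis,
so the sign of a basic arc ending there is the one dictated by the manifold. -/
theorem eventually_pos_of_hasSign (hb : 0 < b) (ha : 1 < a) (hba : b ≤ a - 1) {s e t : ℝ} {q : ℤˣ}
    {k l : ℤ} (hkl : k < l) (hse : s < e)
    (hk : (unstableParam a b hb (unstableEigenvalue a b ^ k * t)).1 = 0)
    (hl : (unstableParam a b hb (unstableEigenvalue a b ^ l * t)).1 = 0)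
    (ht : unstableEigenvalue a b ^ l * t ∈ Icc s e)
    (hq : HasSign (unstableParam a b hb '' Icc s e) q) :
    ∀ᶠ r in 𝓝[≠] t,
      0 < ((q : ℤ) : ℝ) * (unstableParam a b hb (unstableEigenvalue a b ^ l * r)).1 := by
  have hμ := unstableEigenvalue_ne_zero hb ha
  have hμl : unstableEigenvalue a b ^ l ≠ 0 := zpow_ne_zero _ hμ
  have hfold : Folds a b hb (unstableEigenvalue a b ^ l * t) := by
    have h := folds_of_fst_eq_zero hb ha hba hk (l - k - 1).toNat
    rwa [← mul_assoc, ← zpow_natCast, ← zpow_add₀ hμ,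
      show (((l - k - 1).toNat + 1 : ℕ) : ℤ) + k = l by omega] at h
  obtain ⟨x, hx, hxt⟩ : ∃ x ∈ Icc s e, x ≠ unstableEigenvalue a b ^ l * t := by
    by_cases h : s = unstableEigenvalue a b ^ l * t
    · exact ⟨e, right_mem_Icc.2 hse.le, by rw [← h]; exact hse.ne'⟩
    · exact ⟨s, left_mem_Icc.2 hse.le, h⟩
  -- the side of `t` along which the arc runs
  obtain ⟨σ, hσ⟩ : ∃ σ, unstableEigenvalue a b ^ l * σ = x - unstableEigenvalue a b ^ l * t :=
    ⟨_, mul_div_cancel₀ _ hμl⟩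
  have hσ0 : σ ≠ 0 := fun h => sub_ne_zero.2 hxt (by rw [← hσ, h, mul_zero])
  obtain ⟨ε, hε, h1, h2⟩ := hfold (unstableEigenvalue a b ^ l * σ) (mul_ne_zero hμl hσ0)
  have h1' := h1.eventually_pos hl
  have h2' := h2.eventually_pos hl
  have hqε : 0 < ((q : ℤ) : ℝ) * ε := by
    obtain ⟨h, hh, hI⟩ := (h1'.and (Ioo_mem_nhdsGT (zero_lt_one' ℝ))).exists
    have hmem : unstableEigenvalue a b ^ l * t + unstableEigenvalue a b ^ l * σ * h ∈ Icc s e := by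
      rw [hσ]
      exact ⟨by nlinarith [ht.1, hx.1, hI.1, hI.2], by nlinarith [ht.2, hx.2, hI.1, hI.2]⟩
    have h3 := hq _ (mem_image_of_mem _ hmem)
    refine lt_of_le_of_ne ?_ (mul_ne_zero (intUnits_cast_ne_zero q) hε).symm
    by_contra! hneg
    have hx0 := right_ne_zero_of_mul hh.ne'
    have := mul_self_pos.2 hx0
    nlinarith [mul_nonneg h3 hh.le, mul_pos_of_neg_of_neg hneg (neg_lt_zero.2 this)]
  refine eventually_punctured_of_two_sides hσ0 ?_ ?_
  · filter_upwards [h1'] with h hh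
    rw [mul_add, ← mul_assoc]
    exact mul_pos_of_mul_pos_of_mul_pos hqε hh
  · filter_upwards [h2'] with h hh
    rw [mul_add, ← mul_assoc, mul_neg]
    exact mul_pos_of_mul_pos_of_mul_pos hqε hh

/-- The pullbacks along the orbit of the arcs of a path are nested compact intervals, so some orbit
follows the path. -/
theorem exists_orbit_of_path (hb : 0 < b) (ha : 1 < a) (hba : b < a + 1) {s e : ℤ → ℝ}
    (hse : ∀ n, s n < e n)
    (hadj : ∀ n, unstableParam a b hb '' Icc (s (n + 1)) (e (n + 1)) ⊆
      lozi a b hb '' (unstableParam a b hb '' Icc (s n) (e n))) :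
    ∃ t, ∀ n : ℤ, unstableEigenvalue a b ^ n * t ∈ Icc (s n) (e n) := by
  have hμ := unstableEigenvalue_ne_zero hb ha
  let K : ℤ → Set ℝ := fun n => {t | unstableEigenvalue a b ^ n * t ∈ Icc (s n) (e n)}
  have hstep : ∀ n, K (n + 1) ⊆ K n := by
    intro n t ht
    obtain ⟨_, ⟨y, hy, rfl⟩, hyt⟩ := hadj n (mem_image_of_mem _ ht)
    rw [lozi_unstableParam hb ha hba] at hyt
    have h1 := injective_unstableParam hb ha hba hyt
    rw [add_comm, zpow_one_add₀ hμ, mul_assoc] at h1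
    rwa [mul_left_cancel₀ hμ h1] at hy
  have hanti : Antitone K := antitone_int_of_succ_le hstep
  have hclosed : ∀ n, IsClosed (K n) := fun n => isClosed_Icc.preimage (continuous_const_mul _)
  have hne : ∀ n, (K n).Nonempty := fun n =>
    ⟨(unstableEigenvalue a b ^ n)⁻¹ * s n, by
      change unstableEigenvalue a b ^ n * _ ∈ Icc (s n) (e n)
      rw [mul_inv_cancel_left₀ (zpow_ne_zero n hμ)]
      exact left_mem_Icc.2 (hse n).le⟩
  have hcompact : IsCompact (K 0) := by
    have : K 0 = Icc (s 0) (e 0) := by ext; simp [K]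
    rw [this]
    exact isCompact_Icc
  obtain ⟨t, ht⟩ := IsCompact.nonempty_iInter_of_sequence_nonempty_isCompact_isClosed
    (fun n : ℕ => K n) (fun n => by push_cast; exact hstep n) (fun n => hne n)
    (by simpa using hcompact) (fun n => hclosed n)
  refine ⟨t, fun n => ?_⟩
  exact hanti (Int.self_le_toNat n) (mem_iInter.1 ht n.toNat)

theorem isEssentialRAdmissible_of_isSignPath (hb : 0 < b) (ha : 1 < a) (hba : b ≤ a - 1)
    {p : ℤ → ℤˣ} (hp : IsSignPath a b hb p) : IsEssentialRAdmissible a b hb p := by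
  have hba' : b < a + 1 := by linarith
  obtain ⟨B, hadj, hsign⟩ := hp
  choose s e hI hB using fun n => (isBasicArc_iff hb ha hba').1 (B n).2
  simp only [foldingTree, hB] at hadj
  simp only [hB] at hsign
  obtain ⟨t, ht⟩ := exists_orbit_of_path hb ha hba' (fun n => (hI n).1) hadj
  refine ⟨unstableParam a b hb t, ?_, fun n => ?_, t, rfl, fun k l hkl hk hl => ?_⟩
  · rw [← range_unstableParam hb ha hba']
    exact mem_range_self t
  · rw [lozi_zpow_unstableParam hb ha hba']
    exact hsign n _ (mem_image_of_mem _ (ht n))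
  · rw [lozi_zpow_unstableParam hb ha hba'] at hk hl
    simp only [lozi_zpow_unstableParam hb ha hba']
    exact eventually_pos_of_hasSign hb ha hba hkl (hI l).1 hk hl (ht l) (hsign l)

end Main

theorem mainTheorem2 (a b : ℝ) (hb : 0 < b) (h₁ : b + 2 < a * √2)
    (h₂ : b < (a ^ 2 - 1) / (2 * a + 1)) (h₃ : 2 * a + b < 4) (p : ℤ → ℤˣ) :
    IsEssentialRAdmissible a b hb p ↔ IsSignPath a b hb p := by
  have ha : 1 < a := by
    have h2 : 0 < √2 := by positivity
    have h3 : √2 * √2 = 2 := Real.mul_self_sqrt (by norm_num)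
    by_contra! hle
    nlinarith
  have hba : b ≤ a - 1 := by
    rw [lt_div_iff₀ (by linarith)] at h₂
    nlinarith
  exact ⟨isSignPath_of_isEssentialRAdmissible hb ha hba,
    isEssentialRAdmissible_of_isSignPath hb ha hba⟩
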